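/- For an affine complex plane $V\subset\mathbb{C}^4$ put $V^\times = V\cap(\mathbb{C}^\times)^4$, a real 4-dimensional manifold, and let $\mathcal{A}\colon V^\times\to\mathbb{R}^4$, $\mathcal{C}\colon V^\times\to(S^1)^4$ and $\mathcal{B}\colon V^\times\to(\mathbb{R}P^1)^4$ be the restrictions to $V^\times$ of the coordinatewise maps $z\mapsto\log|z|$, $z\mapsto z/|z|$ and $z\mapsto[\operatorname{Re} z:\operatorname{Im} z]$ (the amoeba, coamoeba and rolled coamoeba maps of $V$). A point of $V^\times$ is critical for one of these maps if the real differential of the map there has rank less than $4$. For a generic affine plane $V\subset\mathbb{C}^4$ the maps $\mathcal{A}$, $\mathcal{B}$ and $\mathcal{C}$ have the same locus $Z$ of critical points, and $Z$ is a nonsingular 3-manifold, that is, a nonempty smooth embedded real submanifold of dimension $3$ of $\mathbb{C}^4$ (contained in $V^\times$). Here "generic" means: there is a nonzero real polynomial $f$ in the real and imaginary parts of the coordinates of three vectors of $\mathbb{C}^4$ such that the claim holds for every plane $V=p+\mathbb{C}u+\mathbb{C}v$, with $u,v$ linearly independent, for which $f(p,u,v)\neq 0$. -/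

import Mathlib

open scoped ContDiff

noncomputable section

/-- The map `Log : (ℂˣ)⁴ → ℝ⁴`, `z ↦ (log |z₁|, …, log |z₄|)`. -/
def logMap (z : Fin 4 → ℂ) : Fin 4 → ℝ := fun i => Real.log ‖z i‖

/-- The map `Arg : (ℂˣ)⁴ → (S¹)⁴`, `z ↦ (z₁ / |z₁|, …, z₄ / |z₄|)`, where `S¹` is the unit circle
of `ℂ`, so that `(S¹)⁴` is a 4-dimensional submanifold of `ℂ⁴`. -/
def argMap (z : Fin 4 → ℂ) : Fin 4 → ℂ := fun i => z i / (‖z i‖ : ℂ)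

/-- The map `2Arg : (ℂˣ)⁴ → (ℝP¹)⁴` sending each coordinate to the real line through the origin of
`ℂ` that it spans.  The real projective line `ℝP¹` of `ℂ` is identified with the unit circle through
the diffeomorphism `[z] ↦ z² / |z|²` (the doubled argument). -/
def twoArgMap (z : Fin 4 → ℂ) : Fin 4 → ℂ := fun i => (z i / (‖z i‖ : ℂ)) ^ 2

/-- The real differential at `z` of the restriction of `F` to the affine subspace `V` of `ℂ⁴`:
the real Fréchet derivative of `F` at `z`, restricted to the directions of `V`. -/
def diffAlong {W : Type*} [NormedAddCommGroup W] [NormedSpace ℝ W]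
    (V : AffineSubspace ℂ (Fin 4 → ℂ)) (F : (Fin 4 → ℂ) → W) (z : Fin 4 → ℂ) :
    (V.direction.restrictScalars ℝ) →ₗ[ℝ] W :=
  ((fderiv ℝ F z : (Fin 4 → ℂ) →L[ℝ] W) : (Fin 4 → ℂ) →ₗ[ℝ] W).comp
    (V.direction.restrictScalars ℝ).subtype

/-- The locus of critical points of the restriction of `F` to `V^× = V ∩ (ℂˣ)⁴`, for a map `F` from
`(ℂˣ)⁴` to a 4-dimensional real manifold (contained in `W`): the points of `V^×` at which the
differential of the restriction has real rank less than 4, i.e. is not onto the tangent space of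
the 4-dimensional target. -/
def criticalLocus {W : Type*} [NormedAddCommGroup W] [NormedSpace ℝ W]
    (V : AffineSubspace ℂ (Fin 4 → ℂ)) (F : (Fin 4 → ℂ) → W) : Set (Fin 4 → ℂ) :=
  {z | z ∈ V ∧ (∀ i, z i ≠ 0) ∧ Module.finrank ℝ (LinearMap.range (diffAlong V F z)) < 4}

/-- `S` is a smooth (embedded, nonsingular) `d`-dimensional submanifold of the real normed space
`E`: around each of its points there is a smooth coordinate system of `E`, with values in
`ℝᵈ × ℝᶜ`, in which `S` is given by the vanishing of the last `c` coordinates. -/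
def IsSmoothSubmanifold {E : Type*} [NormedAddCommGroup E] [NormedSpace ℝ E]
    (d : ℕ) (S : Set E) : Prop :=
  ∀ p ∈ S, ∃ (c : ℕ) (e : OpenPartialHomeomorph E
      (EuclideanSpace ℝ (Fin d) × EuclideanSpace ℝ (Fin c))),
    p ∈ e.source ∧ ContDiffOn ℝ ∞ e e.source ∧ ContDiffOn ℝ ∞ e.symm e.target ∧
      ∀ x ∈ e.source, x ∈ S ↔ (e x).2 = 0

/-- The 24 real coordinates (real and imaginary parts) of a triple `(p, u, v)` of vectors
of `ℂ⁴`. -/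
def realCoords (p u v : Fin 4 → ℂ) : (Fin 3 × Fin 4) ⊕ (Fin 3 × Fin 4) → ℝ :=
  Sum.elim (fun j => (![p, u, v] j.1 j.2).re) (fun j => (![p, u, v] j.1 j.2).im)

/-- The property `P` holds for a generic affine (complex) plane in `ℂ⁴`: it holds for every plane
`p + ℂ u + ℂ v`, with `u`, `v` linearly independent, outside a proper real algebraic subset of the
space of triples `(p, u, v)`. -/
def ForGenericPlane (P : AffineSubspace ℂ (Fin 4 → ℂ) → Prop) : Prop :=
  ∃ f : MvPolynomial ((Fin 3 × Fin 4) ⊕ (Fin 3 × Fin 4)) ℝ, f ≠ 0 ∧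
    ∀ p u v : Fin 4 → ℂ, LinearIndependent ℂ ![u, v] →
      MvPolynomial.eval (realCoords p u v) f ≠ 0 →
        P (AffineSubspace.mk' p (Submodule.span ℂ {u, v}))

end

open scoped ComplexConjugate
open Topology

/-! Let W be the direction plane of V. The differential of the argument map at z kills w ∈ W exactly
when w = r z coordinatewise with r real. Squaring a unit complex number is a local diffeomorphism,
and the differential of the logarithm map kills w exactly when that of the argument map kills i w ∈
W. So the three critical loci coincide, and inside V they are the zero set of one real 4 × 4
determinant, `argJacobian`.

Smoothness requires this determinant to vanish only to first order along V. Two facts give this. If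
the cross ratio of W is not real, W is not a coordinatewise rescaling of a real plane
(`det_eq_zero_of_real_scaling`), so the kernel at a critical point is a real line. If moreover the 3
× 3 minors of (p, u, v) do not vanish, then W ⊕ r W = ℂ⁴ (`IsGenericFrame.transverse`); were every
derivative along W zero, this would make the singular Jacobian surjective. A critical point is
written down explicitly in `IsGenericFrame.exists_critical`. -/

/-! ### Plücker coordinates, cross ratio and transversality -/

/-- The Plücker coordinate `u i * v j - u j * v i` of the span of `u` and `v`. -/
def plucker (u v : Fin 4 → ℂ) (i j : Fin 4) : ℂ := u i * v j - u j * v i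

/-- The `3 × 3` minor of the matrix with columns `p`, `u`, `v` in the rows `i`, `j`, `k`. -/
def minor (p u v : Fin 4 → ℂ) (i j k : Fin 4) : ℂ :=
  p i * plucker u v j k - p j * plucker u v i k + p k * plucker u v i j

/-- The planes `p + ℂ u + ℂ v` in general position with respect to the coordinate hyperplanes and
the real structure: the cross ratio of `ℂ u + ℂ v` is not real, and the projection of the plane
along each coordinate axis misses the origin. -/
structure IsGenericFrame (p u v : Fin 4 → ℂ) : Prop where
  cross : (plucker u v 0 1 * plucker u v 2 3 * conj (plucker u v 0 3 * plucker u v 1 2)).im ≠ 0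
  minor012 : minor p u v 0 1 2 ≠ 0
  minor013 : minor p u v 0 1 3 ≠ 0
  minor023 : minor p u v 0 2 3 ≠ 0
  minor123 : minor p u v 1 2 3 ≠ 0

/-- Four of the coordinates are factors of the hypothesis. If one of the other two vanished, the
Plücker relation would make the two products opposite, and the hypothesis would be the imaginary
part of a real number. -/
lemma plucker_ne_zero {u v : Fin 4 → ℂ}
    (h : (plucker u v 0 1 * plucker u v 2 3 * conj (plucker u v 0 3 * plucker u v 1 2)).im ≠ 0) :
    plucker u v 0 1 ≠ 0 ∧ plucker u v 0 2 ≠ 0 ∧ plucker u v 0 3 ≠ 0 ∧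
      plucker u v 1 2 ≠ 0 ∧ plucker u v 1 3 ≠ 0 ∧ plucker u v 2 3 ≠ 0 := by
  have rel : plucker u v 0 1 * plucker u v 2 3 + plucker u v 0 3 * plucker u v 1 2 =
      plucker u v 0 2 * plucker u v 1 3 := by simp only [plucker]; ring
  have key : plucker u v 0 2 * plucker u v 1 3 ≠ 0 := by
    intro h0
    apply h
    have : plucker u v 0 1 * plucker u v 2 3 = -(plucker u v 0 3 * plucker u v 1 2) := by
      linear_combination rel + h0
    rw [this, neg_mul, Complex.mul_conj]
    simp
  refine ⟨?_, left_ne_zero_of_mul key, ?_, ?_, right_ne_zero_of_mul key, ?_⟩ <;>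
    · intro h0
      apply h
      simp [h0]

/-- A plane with non-real cross ratio contains no pair of independent vectors that become real
after rescaling the coordinates. -/
lemma det_eq_zero_of_real_scaling {u v : Fin 4 → ℂ}
    (h : (plucker u v 0 1 * plucker u v 2 3 * conj (plucker u v 0 3 * plucker u v 1 2)).im ≠ 0)
    (x : Fin 4 → ℂ) (a b : Fin 4 → ℝ) {s t s' t' : ℂ}
    (ha : ∀ i, a i * x i = s * u i + t * v i) (hb : ∀ i, b i * x i = s' * u i + t' * v i) :
    s * t' - s' * t = 0 := by
  by_contra hD
  have key : ∀ i j, (s * t' - s' * t) * plucker u v i j =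
      ((a i * b j - a j * b i : ℝ) : ℂ) * (x i * x j) := by
    intro i j
    push_cast
    have : (s * t' - s' * t) * plucker u v i j = (s * u i + t * v i) * (s' * u j + t' * v j) -
        (s * u j + t * v j) * (s' * u i + t' * v i) := by simp only [plucker]; ring
    rw [this, ← ha, ← ha, ← hb, ← hb]; ring
  set D := s * t' - s' * t
  -- Both products carry the same factor `x 0 * x 1 * x 2 * x 3`, so their ratio is real.
  have e1 : D ^ 2 * (plucker u v 0 1 * plucker u v 2 3) =
      (((a 0 * b 1 - a 1 * b 0) * (a 2 * b 3 - a 3 * b 2) : ℝ) : ℂ) *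
        (x 0 * x 1 * x 2 * x 3) := by
    have h1 := key 0 1
    have h2 := key 2 3
    push_cast at *
    linear_combination (D * plucker u v 2 3) * h1 + (a 0 * b 1 - a 1 * b 0) * (x 0 * x 1) * h2
  have e2 : D ^ 2 * (plucker u v 0 3 * plucker u v 1 2) =
      (((a 0 * b 3 - a 3 * b 0) * (a 1 * b 2 - a 2 * b 1) : ℝ) : ℂ) *
        (x 0 * x 1 * x 2 * x 3) := by
    have h1 := key 0 3
    have h2 := key 1 2
    push_cast at *
    linear_combination (D * plucker u v 1 2) * h1 + (a 0 * b 3 - a 3 * b 0) * (x 0 * x 3) * h2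
  have e3 : ((Complex.normSq (D ^ 2) : ℝ) : ℂ) * (plucker u v 0 1 * plucker u v 2 3 *
      conj (plucker u v 0 3 * plucker u v 1 2)) =
      (((a 0 * b 1 - a 1 * b 0) * (a 2 * b 3 - a 3 * b 2) *
        ((a 0 * b 3 - a 3 * b 0) * (a 1 * b 2 - a 2 * b 1)) *
        Complex.normSq (x 0 * x 1 * x 2 * x 3) : ℝ) : ℂ) := by
    have e4 := congrArg conj e2
    rw [map_mul conj (D ^ 2), map_mul conj (Complex.ofReal _), Complex.conj_ofReal] at e4
    rw [← Complex.mul_conj]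
    rw [Complex.ofReal_mul _ (Complex.normSq _), ← Complex.mul_conj, Complex.ofReal_mul]
    calc _ = (D ^ 2 * (plucker u v 0 1 * plucker u v 2 3)) *
        (conj (D ^ 2) * conj (plucker u v 0 3 * plucker u v 1 2)) := by ring
      _ = _ := by rw [e1, e4]; ring
  have e5 := congrArg Complex.im e3
  rw [Complex.im_ofReal_mul, Complex.ofReal_im, mul_eq_zero] at e5
  rcases e5 with e5 | e5
  · rw [Complex.normSq_eq_zero] at e5
    exact hD (pow_eq_zero_iff (two_ne_zero) |>.1 e5)
  · exact h e5

/-- Cramer's rule. When all Plücker coordinates are nonzero, it says that a nonzero vector of the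
plane has at most one zero coordinate. -/
lemma coeffs_eq_zero_of_plucker_ne_zero {u v : Fin 4 → ℂ} {i j : Fin 4}
    (h : plucker u v i j ≠ 0) {s t : ℂ}
    (hi : s * u i + t * v i = 0) (hj : s * u j + t * v j = 0) : s = 0 ∧ t = 0 := by
  constructor
  · refine (mul_eq_zero.1 ?_).resolve_right h
    simp only [plucker]; linear_combination v j * hi - v i * hj
  · refine (mul_eq_zero.1 ?_).resolve_right h
    simp only [plucker]; linear_combination u i * hj - u j * hi

/-- If `r z` lies in the span of `u` and `v`, for a point `z` of `p + ℂ u + ℂ v`, then no three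
coordinates of `r` coincide. -/
lemma scaling_eq_zero_of_three_eq {p u v : Fin 4 → ℂ} {i j k : Fin 4}
    (hm : minor p u v i j k ≠ 0) (hij : plucker u v i j ≠ 0) {z : Fin 4 → ℂ}
    (hz : ∀ l, z l ≠ 0) {s t s' t' : ℂ} (hzV : ∀ l, z l = p l + s * u l + t * v l)
    {r : Fin 4 → ℝ} (hr : ∀ l, r l * z l = s' * u l + t' * v l)
    (h1 : r i = r j) (h2 : r i = r k) : r = 0 := by
  have hi := hr i
  have hj := hr j
  have hk := hr k
  rw [← h1] at hj
  rw [← h2] at hk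
  rw [hzV] at hi hj hk
  -- In rows `i`, `j`, `k` the columns `r i • z`, `u`, `v` are dependent; the `u` and `v` parts of
  -- `z` drop out of their determinant, leaving `r i` times the minor.
  have h0 : (r i : ℂ) = 0 := by
    refine (mul_eq_zero.1 ?_).resolve_right hm
    simp only [minor, plucker]
    linear_combination (u j * v k - u k * v j) * hi - (u i * v k - u k * v i) * hj +
      (u i * v j - u j * v i) * hk
  rw [h0, zero_mul] at hi hj
  obtain ⟨rfl, rfl⟩ := coeffs_eq_zero_of_plucker_ne_zero hij hi.symm hj.symm
  ext l
  have := hr l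
  simpa [hz l] using this

/-- At a critical point, the direction of the plane and its rescaling are transverse. -/
lemma IsGenericFrame.transverse {p u v : Fin 4 → ℂ} (h : IsGenericFrame p u v) {z : Fin 4 → ℂ}
    (hz : ∀ l, z l ≠ 0) {s t s' t' : ℂ} (hzV : ∀ l, z l = p l + s * u l + t * v l)
    {r : Fin 4 → ℝ} (hr0 : r ≠ 0) (hr : ∀ l, r l * z l = s' * u l + t' * v l)
    {c d c' d' : ℂ} (hw : ∀ l, r l * (c * u l + d * v l) = c' * u l + d' * v l) :
    c = 0 ∧ d = 0 := by
  obtain ⟨h01, h02, h03, h12, h13, h23⟩ := plucker_ne_zero h.cross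
  -- The vector is its own rescaling, by the real factors `1` and `r`. So its image under `r` is a
  -- complex multiple of it, and `r` is constant on its support, which has at least three elements.
  have hD := det_eq_zero_of_real_scaling h.cross (fun l => c * u l + d * v l) 1 r
    (s := c) (t := d) (by simp) hw
  have key : ∀ i j, c * u i + d * v i ≠ 0 → c * u j + d * v j ≠ 0 → r i = r j := by
    intro i j hi hj
    have : ((c * u i + d * v i) * (c * u j + d * v j)) * ((r i : ℂ) - r j) = 0 := by
      have hi' := hw i
      have hj' := hw j
      linear_combination (c * u j + d * v j) * hi' - (c * u i + d * v i) * hj' -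
        (u i * v j - u j * v i) * hD
    have := (mul_eq_zero.1 this).resolve_left (mul_ne_zero hi hj)
    exact_mod_cast sub_eq_zero.1 this
  by_contra hcd
  have nz : ∀ {i j}, plucker u v i j ≠ 0 → c * u i + d * v i = 0 → c * u j + d * v j ≠ 0 :=
    fun hp hi hj => hcd (coeffs_eq_zero_of_plucker_ne_zero hp hi hj)
  by_cases w0 : c * u 0 + d * v 0 = 0
  · exact hr0 (scaling_eq_zero_of_three_eq h.minor123 h12 hz hzV hr
      (key _ _ (nz h01 w0) (nz h02 w0)) (key _ _ (nz h01 w0) (nz h03 w0)))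
  by_cases w1 : c * u 1 + d * v 1 = 0
  · exact hr0 (scaling_eq_zero_of_three_eq h.minor023 h02 hz hzV hr
      (key _ _ w0 (nz h12 w1)) (key _ _ w0 (nz h13 w1)))
  by_cases w2 : c * u 2 + d * v 2 = 0
  · exact hr0 (scaling_eq_zero_of_three_eq h.minor013 h01 hz hzV hr
      (key _ _ w0 w1) (key _ _ w0 (nz h23 w2)))
  · exact hr0 (scaling_eq_zero_of_three_eq h.minor012 h01 hz hzV hr
      (key _ _ w0 w1) (key _ _ w0 w2))

/-- At a critical point, every vector of `ℂ⁴` is the sum of a direction of the plane and a rescaled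
one. -/
lemma IsGenericFrame.exists_decomposition {p u v : Fin 4 → ℂ} (h : IsGenericFrame p u v)
    {z : Fin 4 → ℂ} (hz : ∀ l, z l ≠ 0) {s t s' t' : ℂ}
    (hzV : ∀ l, z l = p l + s * u l + t * v l) {r : Fin 4 → ℝ} (hr0 : r ≠ 0)
    (hr : ∀ l, r l * z l = s' * u l + t' * v l) (y : Fin 4 → ℂ) :
    ∃ c d c' d' : ℂ, ∀ l, y l = r l * (c * u l + d * v l) + (c' * u l + d' * v l) := by
  let T : (Fin 4 → ℂ) →ₗ[ℂ] (Fin 4 → ℂ) :=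
    { toFun := fun x l => r l * (x 0 * u l + x 1 * v l) + (x 2 * u l + x 3 * v l)
      map_add' := fun x y => by ext l; simp only [Pi.add_apply]; ring
      map_smul' := fun m x => by
        ext l; simp only [Pi.smul_apply, smul_eq_mul, RingHom.id_apply]; ring }
  have hT : Function.Injective T := by
    rw [← LinearMap.ker_eq_bot, LinearMap.ker_eq_bot']
    intro x hx
    have hx' : ∀ l, (r l : ℂ) * (x 0 * u l + x 1 * v l) + (x 2 * u l + x 3 * v l) = 0 :=
      fun l => congrFun hx l
    obtain ⟨h0, h1⟩ := h.transverse hz hzV hr0 hr (c := x 0) (d := x 1) (c' := -x 2) (d' := -x 3)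
      (fun l => by linear_combination hx' l)
    have hx2 : ∀ l, x 2 * u l + x 3 * v l = 0 := fun l => by
      have := hx' l
      rw [h0, h1] at this
      linear_combination this
    obtain ⟨h2, h3⟩ := coeffs_eq_zero_of_plucker_ne_zero (plucker_ne_zero h.cross).1
      (hx2 0) (hx2 1)
    ext l
    fin_cases l <;> assumption
  obtain ⟨x, hx⟩ := (LinearMap.injective_iff_surjective.1 hT) y
  exact ⟨x 0, x 1, x 2, x 3, fun l => (congrFun hx l).symm⟩

/-- The explicit critical point of a generic plane with scaling factors `(0, 2, 2, 1)`. -/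
lemma IsGenericFrame.exists_critical {p u v : Fin 4 → ℂ} (h : IsGenericFrame p u v) :
    ∃ (z : Fin 4 → ℂ) (s t s' t' : ℂ) (r : Fin 4 → ℝ), (∀ l, z l ≠ 0) ∧
      (∀ l, z l = p l + s * u l + t * v l) ∧ r ≠ 0 ∧ ∀ l, r l * z l = s' * u l + t' * v l := by
  obtain ⟨h01, h02, h03, h12, h13, h23⟩ := plucker_ne_zero h.cross
  have hm := h.minor123
  have hm' := h.minor012
  set m := minor p u v 1 2 3 with hmdef
  set m' := minor p u v 0 1 2 with hmdef'
  set a := plucker u v 0 1 with ha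
  set b := plucker u v 0 2 with hb
  set c := plucker u v 0 3 with hc
  set e := plucker u v 1 2 with he
  -- A direction with zero coordinate 0 is proportional to `(0, a, b, c)`, so dividing by the
  -- factors `2, 2, 1` gives `z = (*, μ a, μ b, 2 μ c)`. Its minor in rows 1, 2, 3 must be `m`,
  -- which the Plücker relation reduces to `μ c e = m`; the minor in rows 0, 1, 2 then fixes the
  -- first coordinate.
  obtain ⟨μ, hμ⟩ : ∃ μ : ℂ, μ * (c * e) = m := ⟨m / (c * e), by field_simp⟩
  have hμ0 : μ ≠ 0 := by rintro rfl; simp at hμ; exact hm hμ.symm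
  -- the coefficients are found by solving the rows `1` and `2`
  let s := ((μ * a - p 1) * v 2 - (μ * b - p 2) * v 1) / e
  let t := (u 1 * (μ * b - p 2) - u 2 * (μ * a - p 1)) / e
  refine ⟨![m' / e, μ * a, μ * b, 2 * μ * c], s, t, 2 * -(μ * v 0), 2 * (μ * u 0), ![0, 2, 2, 1],
    ?_, ?_, ?_, ?_⟩
  · intro l
    fin_cases l
    · exact div_ne_zero hm' h12
    · exact mul_ne_zero hμ0 h01
    · exact mul_ne_zero hμ0 h02
    · exact mul_ne_zero (mul_ne_zero two_ne_zero hμ0) h03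
  · have hs : s * e = (μ * a - p 1) * v 2 - (μ * b - p 2) * v 1 := div_mul_cancel₀ _ h12
    have ht : t * e = u 1 * (μ * b - p 2) - u 2 * (μ * a - p 1) := div_mul_cancel₀ _ h12
    have h0 : m' / e * e = m' := div_mul_cancel₀ _ h12
    clear_value s t
    intro l
    apply mul_right_cancel₀ h12
    fin_cases l <;>
      simp only [Fin.zero_eta, Fin.mk_one, Fin.reduceFinMk, Matrix.cons_val, Matrix.cons_val_zero,
        Matrix.cons_val_one, h0]
    · rw [hmdef']
      simp only [minor, ← ha, ← hb, ← he]
      simp only [ha, hb, he, plucker] at *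
      linear_combination -u 0 * hs - v 0 * ht
    · simp only [ha, hb, he, plucker] at *
      linear_combination -u 1 * hs - v 1 * ht
    · simp only [ha, hb, he, plucker] at *
      linear_combination -u 2 * hs - v 2 * ht
    · rw [hmdef] at hμ
      simp only [minor] at hμ
      simp only [ha, hb, hc, he, plucker] at *
      linear_combination -u 3 * hs - v 3 * ht + hμ
  · intro h0
    simpa using congrFun h0 1
  · intro l
    fin_cases l <;> simp [ha, hb, hc, plucker] <;> ring

/-! ### Differentials of the three maps and their critical loci -/

lemma hasFDerivAt_log_norm {a : ℂ} (ha : a ≠ 0) :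
    ∃ D : ℂ →L[ℝ] ℝ, HasFDerivAt (fun x : ℂ => Real.log ‖x‖) D a ∧ ∀ w, D w = (w / a).re := by
  have hn : ‖a‖ ≠ 0 := norm_ne_zero_iff.2 ha
  have h1 : HasFDerivAt (fun x : ℂ => ‖x‖ ^ 2) _ a := (hasFDerivAt_id (𝕜 := ℝ) a).norm_sq
  have h2 := (h1.log (pow_ne_zero 2 hn)).const_mul (1 / 2 : ℝ)
  refine ⟨_, h2.congr_of_eventuallyEq (.of_forall fun x => ?_), fun w => ?_⟩
  · simp [Real.log_pow]
  · have : (w / a).re = (conj a * w).re / ‖a‖ ^ 2 := by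
      rw [← Complex.ofReal_re ((conj a * w).re / ‖a‖ ^ 2), Complex.div_re, ← Complex.normSq_eq_norm_sq]
      simp
      ring
    rw [this]
    simp [Complex.inner]
    field_simp

lemma hasFDerivAt_div_norm {a : ℂ} (ha : a ≠ 0) :
    ∃ D : ℂ →L[ℝ] ℂ, HasFDerivAt (fun x : ℂ => x / (‖x‖ : ℂ)) D a ∧
      ∀ w, D w = a / ‖a‖ * ((w / a).im * Complex.I) := by
  obtain ⟨L, hL, hLw⟩ := hasFDerivAt_log_norm ha
  have h1 : HasFDerivAt (fun x : ℂ => ((Real.log ‖x‖ : ℝ) : ℂ)) (Complex.ofRealCLM.comp L) a :=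
    Complex.ofRealCLM.hasFDerivAt.comp a hL
  -- Away from 0, `x / ‖x‖ = x * exp (-log ‖x‖)`; the radial part of `w` cancels in the product
  -- rule.
  have h2 := (hasFDerivAt_id (𝕜 := ℝ) a).mul h1.neg.cexp
  have hexp : ∀ x : ℂ, x ≠ 0 → Complex.exp (-(Real.log ‖x‖ : ℝ)) = (‖x‖ : ℂ)⁻¹ := by
    intro x hx
    rw [Complex.exp_neg, ← Complex.ofReal_exp, Real.exp_log (norm_pos_iff.2 hx)]
  refine ⟨_, h2.congr_of_eventuallyEq ?_, fun w => ?_⟩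
  · filter_upwards [isOpen_ne.mem_nhds ha] with x hx
    simp [hexp x hx, div_eq_mul_inv]
  · have hw : w / a = (w / a).re + (w / a).im * Complex.I := (Complex.re_add_im _).symm
    have : w = a * (w / a) := by field_simp
    have e1 : a * (w / a).re + a * ((w / a).im * Complex.I) = w := by
      rw [← mul_add, ← hw, ← this]
    simp only [Pi.neg_apply, hexp a ha, id_eq, add_apply, smul_apply,
      neg_apply, ContinuousLinearMap.comp_apply, Complex.ofRealCLM_apply, hLw,
      smul_eq_mul, ContinuousLinearMap.id_apply]
    linear_combination -(‖a‖ : ℂ)⁻¹ * e1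

/-- The two numbers differ by the positive factor `‖a‖ ^ 2`. The right-hand form is polynomial in
the real coordinates of `a`, so the determinant built from it is smooth on all of ℂ⁴. -/
lemma div_im_eq_zero_iff {a w : ℂ} (ha : a ≠ 0) : (w / a).im = 0 ↔ (conj a * w).im = 0 := by
  have : (conj a * w).im = Complex.normSq a * (w / a).im := by
    rw [← Complex.im_ofReal_mul, ← Complex.mul_conj]
    congr 1; field_simp
  rw [this]
  simp [ha]

lemma fderiv_argMap_eq_zero_iff {z : Fin 4 → ℂ} (hz : ∀ i, z i ≠ 0) (w : Fin 4 → ℂ) :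
    fderiv ℝ argMap z w = 0 ↔ ∀ i, (conj (z i) * w i).im = 0 := by
  choose D hD hDw using fun i => hasFDerivAt_div_norm (hz i)
  have h : HasFDerivAt argMap (ContinuousLinearMap.pi fun i =>
      (D i).comp (ContinuousLinearMap.proj i)) z :=
    hasFDerivAt_pi.2 fun i =>
      HasFDerivAt.comp (f := fun x : Fin 4 → ℂ => x i) z (hD i) (hasFDerivAt_apply i z)
  rw [h.fderiv, funext_iff]
  refine forall_congr' fun i => ?_
  rw [← div_im_eq_zero_iff (hz i)]
  simp [hDw, hz i]

lemma fderiv_twoArgMap_eq_zero_iff {z : Fin 4 → ℂ} (hz : ∀ i, z i ≠ 0) (w : Fin 4 → ℂ) :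
    fderiv ℝ twoArgMap z w = 0 ↔ ∀ i, (conj (z i) * w i).im = 0 := by
  choose D hD hDw using fun i => hasFDerivAt_div_norm (hz i)
  have h : HasFDerivAt twoArgMap (ContinuousLinearMap.pi fun i =>
      ((2 • (z i / (‖z i‖ : ℂ)) ^ (2 - 1)) • D i).comp (ContinuousLinearMap.proj i)) z := by
    refine hasFDerivAt_pi.2 fun i => ?_
    exact HasFDerivAt.comp (f := fun x : Fin 4 → ℂ => x i) z ((hD i).pow 2)
      (hasFDerivAt_apply i z)
  rw [h.fderiv, funext_iff]
  refine forall_congr' fun i => ?_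
  rw [← div_im_eq_zero_iff (hz i)]
  simp [hDw, hz i]

lemma fderiv_logMap_eq_zero_iff {z : Fin 4 → ℂ} (hz : ∀ i, z i ≠ 0) (w : Fin 4 → ℂ) :
    fderiv ℝ logMap z w = 0 ↔ ∀ i, (conj (z i) * (Complex.I * w i)).im = 0 := by
  choose D hD hDw using fun i => hasFDerivAt_log_norm (hz i)
  have h : HasFDerivAt logMap (ContinuousLinearMap.pi fun i =>
      (D i).comp (ContinuousLinearMap.proj i)) z :=
    hasFDerivAt_pi.2 fun i =>
      HasFDerivAt.comp (f := fun x : Fin 4 → ℂ => x i) z (hD i) (hasFDerivAt_apply i z)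
  rw [h.fderiv, funext_iff]
  refine forall_congr' fun i => ?_
  rw [← div_im_eq_zero_iff (hz i), mul_div_assoc]
  simp [hDw]

/-- The points of `p + ℂ u + ℂ v` off the coordinate hyperplanes at which some nonzero direction
of the plane is a real rescaling of the point. -/
def realDirectionLocus (p u v : Fin 4 → ℂ) : Set (Fin 4 → ℂ) :=
  {z | (∃ s t : ℂ, ∀ l, z l = p l + s * u l + t * v l) ∧ (∀ l, z l ≠ 0) ∧
    ∃ s t : ℂ, (s ≠ 0 ∨ t ≠ 0) ∧ ∀ l, (conj (z l) * (s * u l + t * v l)).im = 0}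

lemma mem_mk'_span_iff {p u v z : Fin 4 → ℂ} :
    z ∈ AffineSubspace.mk' p (Submodule.span ℂ {u, v}) ↔
      ∃ s t : ℂ, ∀ l, z l = p l + s * u l + t * v l := by
  rw [AffineSubspace.mem_mk', Submodule.mem_span_pair]
  refine exists_congr fun s => exists_congr fun t => ?_
  rw [funext_iff]
  refine forall_congr' fun l => ?_
  simp only [Pi.add_apply, Pi.smul_apply, smul_eq_mul, vsub_eq_sub, Pi.sub_apply]
  constructor <;> intro h <;> linear_combination -h

/-- Rank-nullity: the direction plane has real dimension 4, so a drop in rank means a nonzero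
kernel. -/
lemma finrank_range_diffAlong_lt_iff {W : Type*} [NormedAddCommGroup W] [NormedSpace ℝ W]
    {p u v : Fin 4 → ℂ} (huv : LinearIndependent ℂ ![u, v]) (F : (Fin 4 → ℂ) → W)
    (z : Fin 4 → ℂ) :
    Module.finrank ℝ (LinearMap.range
      (diffAlong (AffineSubspace.mk' p (Submodule.span ℂ {u, v})) F z)) < 4 ↔
    ∃ s t : ℂ, (s ≠ 0 ∨ t ≠ 0) ∧ fderiv ℝ F z (s • u + t • v) = 0 := by
  set V := AffineSubspace.mk' p (Submodule.span ℂ {u, v}) with hV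
  have hdir : V.direction = Submodule.span ℂ {u, v} := AffineSubspace.direction_mk' _ _
  have h2 : Module.finrank ℂ V.direction = 2 := by
    rw [hdir]
    have := finrank_span_eq_card huv
    rw [Matrix.range_cons_cons_empty, Fintype.card_fin] at this
    exact this
  have h4 : Module.finrank ℝ (V.direction.restrictScalars ℝ) = 4 := by
    have := finrank_real_of_complex V.direction
    rw [h2] at this
    exact this
  have hrk := (diffAlong V F z).finrank_range_add_finrank_ker
  rw [h4] at hrk
  have hker : Module.finrank ℝ (LinearMap.range (diffAlong V F z)) < 4 ↔
      LinearMap.ker (diffAlong V F z) ≠ ⊥ := by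
    rw [← Submodule.one_le_finrank_iff]
    omega
  rw [hker, Submodule.ne_bot_iff]
  constructor
  · rintro ⟨⟨x, hx⟩, hx1, hx2⟩
    have hx' : x ∈ Submodule.span ℂ {u, v} := hdir ▸ hx
    obtain ⟨s, t, rfl⟩ := Submodule.mem_span_pair.1 hx'
    refine ⟨s, t, ?_, hx1⟩
    by_contra! hst
    exact hx2 (by simp [hst])
  · rintro ⟨s, t, hst, h⟩
    refine ⟨⟨s • u + t • v, ?_⟩, h, ?_⟩
    · rw [hdir]
      exact Submodule.mem_span_pair.2 ⟨s, t, rfl⟩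
    · intro h0
      have := LinearIndependent.pair_iff.1 huv s t (congrArg Subtype.val h0)
      tauto

lemma criticalLocus_argMap {p u v : Fin 4 → ℂ} (huv : LinearIndependent ℂ ![u, v]) :
    criticalLocus (AffineSubspace.mk' p (Submodule.span ℂ {u, v})) argMap =
      realDirectionLocus p u v := by
  ext z
  refine and_congr mem_mk'_span_iff (and_congr_right fun hz => ?_)
  rw [finrank_range_diffAlong_lt_iff huv]
  simp only [fderiv_argMap_eq_zero_iff hz, Pi.add_apply, Pi.smul_apply, smul_eq_mul]

lemma criticalLocus_twoArgMap {p u v : Fin 4 → ℂ} (huv : LinearIndependent ℂ ![u, v]) :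
    criticalLocus (AffineSubspace.mk' p (Submodule.span ℂ {u, v})) twoArgMap =
      realDirectionLocus p u v := by
  ext z
  refine and_congr mem_mk'_span_iff (and_congr_right fun hz => ?_)
  rw [finrank_range_diffAlong_lt_iff huv]
  simp only [fderiv_twoArgMap_eq_zero_iff hz, Pi.add_apply, Pi.smul_apply, smul_eq_mul]

/-- Multiplication by `Complex.I` preserves the direction plane and exchanges this kernel condition
with that of the argument map. -/
lemma criticalLocus_logMap {p u v : Fin 4 → ℂ} (huv : LinearIndependent ℂ ![u, v]) :
    criticalLocus (AffineSubspace.mk' p (Submodule.span ℂ {u, v})) logMap =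
      realDirectionLocus p u v := by
  ext z
  refine and_congr mem_mk'_span_iff (and_congr_right fun hz => ?_)
  rw [finrank_range_diffAlong_lt_iff huv]
  simp only [fderiv_logMap_eq_zero_iff hz, Pi.add_apply, Pi.smul_apply, smul_eq_mul]
  constructor
  · rintro ⟨s, t, hst, h⟩
    refine ⟨Complex.I * s, Complex.I * t, by simpa using hst, fun l => ?_⟩
    rw [← h l]
    ring_nf
  · rintro ⟨s, t, hst, h⟩
    refine ⟨-Complex.I * s, -Complex.I * t, by simpa using hst, fun l => ?_⟩
    rw [← h l]
    congr 2
    linear_combination (-(s * u l + t * v l)) * Complex.I_mul_I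

/-! ### Submersions and first-order vanishing of determinants -/

/-- A set that is locally the zero set of a smooth submersion to a space of dimension `c` is a
smooth submanifold of codimension `c`. -/
lemma isSmoothSubmanifold_of_submersion {E F : Type*} [NormedAddCommGroup E] [NormedSpace ℝ E]
    [FiniteDimensional ℝ E] [NormedAddCommGroup F] [NormedSpace ℝ F] [FiniteDimensional ℝ F]
    {d : ℕ} (hd : Module.finrank ℝ E = d + Module.finrank ℝ F) {S : Set E}
    (h : ∀ p ∈ S, ∃ U ∈ 𝓝 p, ∃ g : E → F, ContDiff ℝ ∞ g ∧
      Function.Surjective (fderiv ℝ g p) ∧ ∀ x ∈ U, x ∈ S ↔ g x = 0) :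
    IsSmoothSubmanifold d S := by
  intro p hp
  obtain ⟨U, hU, g, hg, hsurj, hS⟩ := h p hp
  let c := Module.finrank ℝ F
  obtain ⟨φ⟩ : Nonempty (F ≃L[ℝ] EuclideanSpace ℝ (Fin c)) :=
    FiniteDimensional.nonempty_continuousLinearEquiv_of_finrank_eq (by simp [c])
  have hK : Module.finrank ℝ (LinearMap.ker (fderiv ℝ g p : E →ₗ[ℝ] F)) = d := by
    have h1 := (fderiv ℝ g p : E →ₗ[ℝ] F).finrank_range_add_finrank_ker
    rw [LinearMap.range_eq_top.2 hsurj, finrank_top, hd] at h1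
    omega
  obtain ⟨ψ⟩ : Nonempty ((LinearMap.ker (fderiv ℝ g p : E →ₗ[ℝ] F)) ≃L[ℝ]
      EuclideanSpace ℝ (Fin d)) :=
    FiniteDimensional.nonempty_continuousLinearEquiv_of_finrank_eq (by simp [hK])
  -- A projection onto the kernel of the differential completes `g` to a local coordinate system.
  obtain ⟨π, hπ⟩ := LinearMap.exists_leftInverse_of_injective
    (LinearMap.ker (fderiv ℝ g p : E →ₗ[ℝ] F)).subtype (Submodule.ker_subtype _)
  let P : E →L[ℝ] EuclideanSpace ℝ (Fin d) :=
    (ψ : _ →L[ℝ] EuclideanSpace ℝ (Fin d)).comp (LinearMap.toContinuousLinearMap π)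
  let Φ : E → EuclideanSpace ℝ (Fin d) × EuclideanSpace ℝ (Fin c) := fun x => (P x, φ (g x))
  have hΦ : ContDiff ℝ ∞ Φ := P.contDiff.prodMk (φ.contDiff.comp hg)
  let D : E →L[ℝ] EuclideanSpace ℝ (Fin d) × EuclideanSpace ℝ (Fin c) :=
    P.prod ((φ : F →L[ℝ] _).comp (fderiv ℝ g p))
  have hD : HasFDerivAt Φ D p :=
    P.hasFDerivAt.prodMk
      (φ.hasFDerivAt.comp p (hg.differentiable (by simp) p).hasFDerivAt)
  have hinj : Function.Injective D := by
    refine (injective_iff_map_eq_zero D).2 fun x hx => ?_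
    have hx1 : ψ (π x) = 0 := congrArg Prod.fst hx
    have hx2 : φ (fderiv ℝ g p x) = 0 := congrArg Prod.snd hx
    rw [ContinuousLinearEquiv.map_eq_zero_iff] at hx1 hx2
    have := LinearMap.congr_fun hπ ⟨x, hx2⟩
    simp only [LinearMap.comp_apply, Submodule.subtype_apply, hx1, LinearMap.id_apply] at this
    exact (congrArg Subtype.val this).symm
  let De : E ≃L[ℝ] EuclideanSpace ℝ (Fin d) × EuclideanSpace ℝ (Fin c) :=
    (LinearEquiv.ofInjectiveOfFinrankEq (D : E →ₗ[ℝ] _) hinj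
      (by simp [hd, c])).toContinuousLinearEquiv
  have hDe : (De : E →L[ℝ] _) = D := by ext x <;> rfl
  have hDeriv : HasFDerivAt Φ (De : E →L[ℝ] _) p := hDe ▸ hD
  let e₀ := hΦ.contDiffAt.toOpenPartialHomeomorph Φ hDeriv (by simp)
  -- restrict to the points of `U` at which the differential is invertible
  let O : Set E := interior U ∩
    fderiv ℝ Φ ⁻¹' Set.range ((↑) : (E ≃L[ℝ] EuclideanSpace ℝ (Fin d) × EuclideanSpace ℝ (Fin c)) →
      E →L[ℝ] EuclideanSpace ℝ (Fin d) × EuclideanSpace ℝ (Fin c))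
  have hO : IsOpen O := isOpen_interior.inter
    (ContinuousLinearEquiv.isOpen.preimage (hΦ.continuous_fderiv (by simp)))
  have hpO : p ∈ O := ⟨mem_interior_iff_mem_nhds.2 hU, De, hDeriv.fderiv.symm⟩
  let e := e₀.restrOpen O hO
  refine ⟨c, e, ⟨hΦ.contDiffAt.mem_toOpenPartialHomeomorph_source hDeriv (by simp), hpO⟩,
    hΦ.contDiffOn, ?_, ?_⟩
  · intro y hy
    have hy' := e.map_target hy
    -- The inverse is smooth at every point of the target, not only at the image of `p`, because the
    -- source was cut down to points with invertible differential.
    obtain ⟨A, hA⟩ := hy'.2.2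
    refine (e.contDiffAt_symm (f₀' := A) hy ?_ hΦ.contDiffAt).contDiffWithinAt
    rw [hA]
    exact (hΦ.differentiable (by simp) _).hasFDerivAt
  · intro x hx
    rw [hS x (interior_subset hx.2.1)]
    change _ ↔ φ (g x) = 0
    simp

/-- If a singular matrix `N` has kernel spanned by `x` and `B x` is not in its range, then the
determinant of `N + τ B` vanishes to first order only at `τ = 0`. -/
lemma exists_hasDerivAt_det_ne_zero {n : Type*} [Fintype n] [DecidableEq n] {N B : Matrix n n ℝ}
    {x : n → ℝ} (hx : x ≠ 0) (hNx : N.mulVec x = 0)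
    (hker : ∀ y, N.mulVec y = 0 → ∃ c : ℝ, y = c • x) (hB : ∀ y, N.mulVec y ≠ B.mulVec x) :
    ∃ d ≠ 0, HasDerivAt (fun τ : ℝ => (N + τ • B).det) d 0 := by
  obtain ⟨k, hk⟩ := Function.ne_iff.1 hx
  -- Since `N x = 0`, the columns of `N + τ B` weighted by `x` sum to `τ B x`. Putting this sum in
  -- column `k` gives `x k * det (N + τ B) = τ * det (M τ)`.
  let M : ℝ → Matrix n n ℝ := fun τ => (N + τ • B).updateCol k (B.mulVec x)
  have hdet : ∀ τ : ℝ, (N + τ • B).det = (x k)⁻¹ * (τ * (M τ).det) := by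
    intro τ
    have h1 := Matrix.det_updateCol_sum (N + τ • B) k x
    have h2 : (fun i => ∑ j, x j • (N + τ • B) i j) = τ • B.mulVec x := by
      have h3 : (N + τ • B).mulVec x = τ • B.mulVec x := by
        rw [Matrix.add_mulVec, hNx, zero_add, Matrix.smul_mulVec]
      rw [← h3]
      ext i
      simp [Matrix.mulVec, dotProduct, mul_comm]
    rw [h2, Matrix.det_updateCol_smul] at h1
    simp only [M, h1, smul_eq_mul]
    field_simp [show x k ≠ 0 from hk]
  -- For a kernel vector `y` of `M 0`: if `y k ≠ 0`, then `B x` is in the range of `N`; if `y k =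
  -- 0`, then `y` is in the kernel of `N`, hence a multiple of `x`, hence zero because `x k ≠ 0`.
  have hM0 : (M 0).det ≠ 0 := by
    intro h0
    obtain ⟨y, hy0, hy⟩ := Matrix.exists_mulVec_eq_zero_iff.2 h0
    have hsplit : N.mulVec (y - Pi.single k (y k)) + y k • B.mulVec x = 0 := by
      rw [← hy]
      ext i
      simp only [M, zero_smul, add_zero, Pi.add_apply, Pi.smul_apply, smul_eq_mul, Matrix.mulVec,
        dotProduct]
      rw [← Finset.add_sum_erase _ _ (Finset.mem_univ k),
        ← Finset.add_sum_erase _ (fun j => N.updateCol k (B.mulVec x) i j * y j)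
          (Finset.mem_univ k)]
      have : ∀ j ∈ Finset.univ.erase k, N i j * (y - Pi.single k (y k) : n → ℝ) j =
          N.updateCol k (B.mulVec x) i j * y j := by
        intro j hj
        have hjk := Finset.ne_of_mem_erase hj
        simp [hjk]
      rw [Finset.sum_congr rfl this]
      simp [Matrix.mulVec, dotProduct]
      ring
    by_cases hyk : y k = 0
    · rw [hyk, Pi.single_zero, sub_zero, zero_smul, add_zero] at hsplit
      obtain ⟨c, rfl⟩ := hker y hsplit
      have : c = 0 := (mul_eq_zero.1 hyk).resolve_right hk
      simp [this] at hy0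
    · refine hB (-(y k)⁻¹ • (y - Pi.single k (y k))) ?_
      rw [Matrix.mulVec_smul, eq_neg_of_add_eq_zero_left hsplit, smul_neg, neg_smul, neg_neg,
        smul_smul, inv_mul_cancel₀ hyk, one_smul]
  refine ⟨(x k)⁻¹ * (M 0).det, mul_ne_zero (inv_ne_zero hk) hM0, ?_⟩
  simp_rw [hdet]
  refine HasDerivAt.const_mul _ ?_
  rw [hasDerivAt_iff_tendsto_slope]
  have hc : Continuous fun τ => (M τ).det := by
    refine Continuous.matrix_det (Continuous.matrix_updateCol k ?_ continuous_const)
    fun_prop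
  refine ((hc.tendsto 0).mono_left nhdsWithin_le_nhds).congr' ?_
  filter_upwards [self_mem_nhdsWithin] with τ hτ
  have : τ ≠ 0 := hτ
  simp [slope_def_field]
  field_simp

/-! ### Smoothness of the critical locus -/

/-- The matrix of the differential of the argument map of `p + ℂ u + ℂ v`, with the row of each
coordinate multiplied by the squared norm of that coordinate. -/
def argJacobian (u v z : Fin 4 → ℂ) : Matrix (Fin 4) (Fin 4) ℝ :=
  Matrix.of fun i k =>
    (conj (z i) * (![u i, Complex.I * u i, v i, Complex.I * v i] : Fin 4 → ℂ) k).im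

lemma argJacobian_mulVec (u v z : Fin 4 → ℂ) (x : Fin 4 → ℝ) (i : Fin 4) :
    (argJacobian u v z).mulVec x i =
      (conj (z i) * ((⟨x 0, x 1⟩ : ℂ) * u i + (⟨x 2, x 3⟩ : ℂ) * v i)).im := by
  simp [argJacobian, Matrix.mulVec, dotProduct, Fin.sum_univ_four]
  ring

lemma argJacobian_mulVec' (u v z : Fin 4 → ℂ) (s t : ℂ) (i : Fin 4) :
    (argJacobian u v z).mulVec ![s.re, s.im, t.re, t.im] i =
      (conj (z i) * (s * u i + t * v i)).im :=
  argJacobian_mulVec u v z _ i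

lemma argJacobian_add_smul (u v z w : Fin 4 → ℂ) (τ : ℝ) :
    argJacobian u v (z + τ • w) = argJacobian u v z + τ • argJacobian u v w := by
  ext i k
  simp [argJacobian]
  ring

lemma contDiff_det_argJacobian (u v : Fin 4 → ℂ) :
    ContDiff ℝ ∞ fun z => (argJacobian u v z).det := by
  simp_rw [Matrix.det_apply]
  refine ContDiff.sum fun σ _ => ContDiff.const_smul _ (contDiff_prod fun i _ => ?_)
  refine Complex.imCLM.contDiff.comp (ContDiff.mul (Complex.conjCLE.contDiff.comp ?_)
    contDiff_const)
  exact contDiff_apply ℝ ℂ _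

lemma det_argJacobian_eq_zero_iff (u v z : Fin 4 → ℂ) :
    (argJacobian u v z).det = 0 ↔
      ∃ s t : ℂ, (s ≠ 0 ∨ t ≠ 0) ∧ ∀ l, (conj (z l) * (s * u l + t * v l)).im = 0 := by
  rw [← Matrix.exists_mulVec_eq_zero_iff]
  constructor
  · rintro ⟨x, hx, h⟩
    refine ⟨⟨x 0, x 1⟩, ⟨x 2, x 3⟩, ?_, fun l => ?_⟩
    · by_contra! h0
      refine hx (funext fun l => ?_)
      have h1 := Complex.ext_iff.1 h0.1
      have h2 := Complex.ext_iff.1 h0.2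
      fin_cases l
      exacts [h1.1, h1.2, h2.1, h2.2]
    · rw [← argJacobian_mulVec, h]; rfl
  · rintro ⟨s, t, hst, h⟩
    refine ⟨![s.re, s.im, t.re, t.im], fun h0 => ?_, funext fun l => ?_⟩
    · have hs : s = 0 := Complex.ext (congrFun h0 0) (congrFun h0 1)
      have ht : t = 0 := Complex.ext (congrFun h0 2) (congrFun h0 3)
      tauto
    · rw [argJacobian_mulVec']; exact h l

lemma exists_real_scaling {z w : ℂ} (hz : z ≠ 0) (h : (conj z * w).im = 0) :
    ∃ r : ℝ, r * z = w := by
  rw [← div_im_eq_zero_iff hz] at h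
  refine ⟨(w / z).re, ?_⟩
  rw [show ((w / z).re : ℂ) = w / z from Complex.ext (by simp) (by simp [h])]
  field_simp

/-- `exists_hasDerivAt_det_ne_zero` applies along a line in the plane, where the matrix is affine in
the parameter. The cross ratio gives the one-dimensional kernel, transversality the direction. -/
lemma IsGenericFrame.exists_fderiv_ne_zero {p u v z : Fin 4 → ℂ} (h : IsGenericFrame p u v)
    (hzK : z ∈ realDirectionLocus p u v) :
    ∃ c d : ℂ, fderiv ℝ (fun z => (argJacobian u v z).det) z (c • u + d • v) ≠ 0 := by
  obtain ⟨⟨s, t, hzV⟩, hz, s', t', hst, him⟩ := hzK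
  choose r hr using fun l => exists_real_scaling (hz l) (him l)
  have h01 := (plucker_ne_zero h.cross).1
  have hr0 : r ≠ 0 := by
    rintro rfl
    have := coeffs_eq_zero_of_plucker_ne_zero h01 (s := s') (t := t')
      (by simpa using (hr 0).symm) (by simpa using (hr 1).symm)
    tauto
  let x : Fin 4 → ℝ := ![s'.re, s'.im, t'.re, t'.im]
  have hNx : (argJacobian u v z).mulVec x = 0 := funext fun l => by
    rw [argJacobian_mulVec']; exact him l
  have hx : x ≠ 0 := fun h0 => by
    have hs : s' = 0 := Complex.ext (congrFun h0 0) (congrFun h0 1)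
    have ht : t' = 0 := Complex.ext (congrFun h0 2) (congrFun h0 3)
    tauto
  have hdet : (argJacobian u v z).det = 0 :=
    (det_argJacobian_eq_zero_iff u v z).2 ⟨s', t', hst, him⟩
  have hker : ∀ y, (argJacobian u v z).mulVec y = 0 → ∃ c : ℝ, y = c • x := by
    intro y hy
    have hyim : ∀ l, (conj (z l) * ((⟨y 0, y 1⟩ : ℂ) * u l + (⟨y 2, y 3⟩ : ℂ) * v l)).im = 0 :=
      fun l => by rw [← argJacobian_mulVec, hy]; rfl
    choose q hq using fun l => exists_real_scaling (hz l) (hyim l)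
    have hD := det_eq_zero_of_real_scaling h.cross z r q hr hq
    obtain ⟨k, hk⟩ := Function.ne_iff.1 hr0
    have hk' : (r k : ℂ) ≠ 0 := by exact_mod_cast hk
    -- both vectors have proportional coefficients, with real factor `q k / r k`
    have e1 : (r k : ℂ) * ⟨y 0, y 1⟩ = q k * s' := by
      apply mul_right_cancel₀ (hz k)
      linear_combination (⟨y 0, y 1⟩ : ℂ) * hr k - s' * hq k - v k * hD
    have e2 : (r k : ℂ) * ⟨y 2, y 3⟩ = q k * t' := by
      apply mul_right_cancel₀ (hz k)
      linear_combination (⟨y 2, y 3⟩ : ℂ) * hr k - t' * hq k + u k * hD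
    have hk0 : r k ≠ 0 := hk
    refine ⟨q k / r k, funext fun l => ?_⟩
    rw [Pi.smul_apply, smul_eq_mul, div_mul_eq_mul_div, eq_div_iff hk0, mul_comm]
    have a1 := congrArg Complex.re e1
    have a2 := congrArg Complex.im e1
    have a3 := congrArg Complex.re e2
    have a4 := congrArg Complex.im e2
    rw [Complex.re_ofReal_mul, Complex.re_ofReal_mul] at a1 a3
    rw [Complex.im_ofReal_mul, Complex.im_ofReal_mul] at a2 a4
    fin_cases l
    exacts [a1, a2, a3, a4]
  obtain ⟨c, d, hB⟩ : ∃ c d : ℂ, ∀ y, (argJacobian u v z).mulVec y ≠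
      (argJacobian u v (c • u + d • v)).mulVec x := by
    by_contra! H
    -- then the Jacobian would be onto
    have hsurj : Function.Surjective (argJacobian u v z).mulVec := by
      intro b
      obtain ⟨c, d, c', d', hy⟩ := h.exists_decomposition hz hzV hr0 hr
        (fun l => (b l : ℂ) * Complex.I / conj (z l))
      obtain ⟨y, hy'⟩ := H c d
      refine ⟨![c'.re, c'.im, d'.re, d'.im] - y, funext fun l => ?_⟩
      rw [Matrix.mulVec_sub, Pi.sub_apply, argJacobian_mulVec', hy', argJacobian_mulVec', ← hr l]
      -- Conjugating turns the derivative term into minus the contribution of the rescaled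
      -- direction, so both summands of the decomposition lie in the range of the Jacobian.
      have h1 : (conj ((c • u + d • v) l) * (r l * z l)).im =
          -(conj (z l) * (r l * (c * u l + d * v l))).im := by
        simp
        ring
      have h2 : conj (z l) * (r l * (c * u l + d * v l) + (c' * u l + d' * v l)) =
          b l * Complex.I := by
        rw [← hy l]
        exact mul_div_cancel₀ _ ((map_ne_zero _).2 (hz l))
      have h3 := congrArg Complex.im h2
      rw [mul_add, Complex.add_im, Complex.im_ofReal_mul, Complex.I_im, mul_one] at h3
      rw [h1]
      linarith
    have hu := Matrix.mulVec_surjective_iff_isUnit.1 hsurj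
    rw [Matrix.isUnit_iff_isUnit_det, hdet] at hu
    exact not_isUnit_zero hu
  obtain ⟨m, hm, hmd⟩ := exists_hasDerivAt_det_ne_zero hx hNx hker hB
  refine ⟨c, d, ?_⟩
  have h1 := ((contDiff_det_argJacobian u v).differentiable (by simp) z).hasFDerivAt
  have h2 : HasDerivAt (fun τ : ℝ => z + τ • (c • u + d • v)) (c • u + d • v) 0 := by
    simpa using ((hasDerivAt_id (0 : ℝ)).smul_const (c • u + d • v)).const_add z
  have h3 := HasFDerivAt.comp_hasDerivAt (f := fun τ : ℝ => z + τ • (c • u + d • v)) (0 : ℝ)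
    (by simpa using h1) h2
  have h4 : (fun z => (argJacobian u v z).det) ∘ (fun τ : ℝ => z + τ • (c • u + d • v)) =
      fun τ => (argJacobian u v z + τ • argJacobian u v (c • u + d • v)).det := by
    funext τ
    simp only [Function.comp, argJacobian_add_smul]
  rw [h4] at h3
  rwa [h3.unique hmd]

/-- Two complex minors cut out the plane and the real determinant cuts out the locus in it: five
real equations in real dimension 8. -/
lemma IsGenericFrame.isSmoothSubmanifold {p u v : Fin 4 → ℂ} (h : IsGenericFrame p u v) :
    IsSmoothSubmanifold 3 (realDirectionLocus p u v) := by
  have h12 := (plucker_ne_zero h.cross).2.2.2.1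
  let L : (Fin 4 → ℂ) →ₗ[ℝ] ℂ × ℂ :=
    { toFun := fun x => (minor x u v 0 1 2, minor x u v 1 2 3)
      map_add' := fun x y => by
        ext1 <;> simp only [minor, Pi.add_apply, Prod.mk_add_mk] <;> ring
      map_smul' := fun m x => by
        ext1 <;> simp only [minor, Pi.smul_apply, Complex.real_smul, Prod.smul_mk,
          RingHom.id_apply] <;> ring }
  have hLdir : ∀ c d : ℂ, L (c • u + d • v) = 0 := fun c d => by
    ext1 <;> simp only [L, LinearMap.coe_mk, AddHom.coe_mk, minor, plucker, Pi.add_apply,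
      Pi.smul_apply, smul_eq_mul, Prod.fst_zero, Prod.snd_zero] <;> ring
  have hL : ∀ x, L x = 0 ↔ ∃ s t : ℂ, x = s • u + t • v := by
    intro x
    constructor
    · intro hx
      have h1 : minor x u v 0 1 2 = 0 := congrArg Prod.fst hx
      have h2 : minor x u v 1 2 3 = 0 := congrArg Prod.snd hx
      obtain ⟨s, hs⟩ : ∃ s, s * plucker u v 1 2 = x 1 * v 2 - x 2 * v 1 :=
        ⟨_, div_mul_cancel₀ _ h12⟩
      obtain ⟨t, ht⟩ : ∃ t, t * plucker u v 1 2 = u 1 * x 2 - u 2 * x 1 :=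
        ⟨_, div_mul_cancel₀ _ h12⟩
      refine ⟨s, t, funext fun l => mul_right_cancel₀ h12 ?_⟩
      simp only [minor, plucker, Pi.add_apply, Pi.smul_apply, smul_eq_mul] at *
      fin_cases l <;> simp only [Fin.zero_eta, Fin.mk_one, Fin.reduceFinMk]
      · linear_combination h1 - u 0 * hs - v 0 * ht
      · linear_combination -u 1 * hs - v 1 * ht
      · linear_combination -u 2 * hs - v 2 * ht
      · linear_combination h2 - u 3 * hs - v 3 * ht
    · rintro ⟨s, t, rfl⟩
      exact hLdir s t
  have hLsurj : Function.Surjective L := by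
    rintro ⟨a, b⟩
    refine ⟨![a / plucker u v 1 2, 0, 0, b / plucker u v 1 2], ?_⟩
    simp only [L, LinearMap.coe_mk, AddHom.coe_mk, minor, Matrix.cons_val, Matrix.cons_val_zero,
      Matrix.cons_val_one, zero_mul, sub_zero, add_zero, zero_add, div_mul_cancel₀ _ h12]
  let L' : (Fin 4 → ℂ) →L[ℝ] ℂ × ℂ := LinearMap.toContinuousLinearMap L
  let G : (Fin 4 → ℂ) → ℝ := fun z => (argJacobian u v z).det
  have hG : ContDiff ℝ ∞ G := contDiff_det_argJacobian u v
  refine isSmoothSubmanifold_of_submersion (F := (ℂ × ℂ) × ℝ)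
    (by simp [Module.finrank_pi_fintype]) fun z hz => ?_
  refine ⟨{x | ∀ l, x l ≠ 0}, ?_, fun x => (L' (x - p), G x),
    (L'.contDiff.comp (contDiff_id.sub contDiff_const)).prodMk hG, ?_, ?_⟩
  · have : IsOpen {x : Fin 4 → ℂ | ∀ l, x l ≠ 0} := by
      simp only [Set.ofPred_forall]
      exact isOpen_iInter_of_finite fun l => isOpen_ne.preimage (continuous_apply l)
    exact this.mem_nhds hz.2.1
  · have hD : HasFDerivAt (fun x => (L' (x - p), G x)) (L'.prod (fderiv ℝ G z)) z :=
      HasFDerivAt.prodMk (L'.hasFDerivAt.comp z ((hasFDerivAt_id z).sub_const p))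
        (hG.differentiable (by simp) z).hasFDerivAt
    rw [hD.fderiv]
    rintro ⟨a, b⟩
    obtain ⟨x, hx⟩ := hLsurj a
    obtain ⟨c, d, hcd⟩ := h.exists_fderiv_ne_zero hz
    let m := fderiv ℝ G z (c • u + d • v)
    have hm : m ≠ 0 := hcd
    -- The added direction is killed by `L'`, so it corrects the last component alone.
    refine ⟨x + ((b - fderiv ℝ G z x) / m) • (c • u + d • v), ?_⟩
    have h1 : L' (c • u + d • v) = 0 := hLdir c d
    have h2 : L' x = a := hx
    have h3 : fderiv ℝ G z (c • u + d • v) = m := rfl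
    rw [map_add, map_smul, ContinuousLinearMap.prod_apply, ContinuousLinearMap.prod_apply, h1, h2,
      h3]
    ext1
    · simp
    · simp [hm]
  · intro x hx
    have hLx : L' (x - p) = 0 ↔ ∃ s t : ℂ, ∀ l, x l = p l + s * u l + t * v l := by
      refine (hL _).trans (exists_congr fun s => exists_congr fun t => ?_)
      rw [funext_iff]
      refine forall_congr' fun l => ?_
      simp only [Pi.sub_apply, Pi.add_apply, Pi.smul_apply, smul_eq_mul]
      constructor <;> intro h <;> linear_combination h
    rw [Prod.mk_eq_zero, hLx, det_argJacobian_eq_zero_iff]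
    exact and_congr_right fun _ => and_iff_right hx

/-! ### Genericity as a real polynomial condition -/

/-- Complex-valued functions of three vectors of `ℂ⁴` that are polynomial in the real
coordinates. -/
def IsRealPolynomial (F : (Fin 4 → ℂ) → (Fin 4 → ℂ) → (Fin 4 → ℂ) → ℂ) : Prop :=
  ∃ f g : MvPolynomial ((Fin 3 × Fin 4) ⊕ (Fin 3 × Fin 4)) ℝ, ∀ p u v,
    F p u v = ⟨MvPolynomial.eval (realCoords p u v) f, MvPolynomial.eval (realCoords p u v) g⟩

namespace IsRealPolynomial

variable {F H : (Fin 4 → ℂ) → (Fin 4 → ℂ) → (Fin 4 → ℂ) → ℂ}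

lemma coord (j : Fin 3) (i : Fin 4) : IsRealPolynomial fun p u v => ![p, u, v] j i :=
  ⟨MvPolynomial.X (Sum.inl (j, i)), MvPolynomial.X (Sum.inr (j, i)), fun p u v => by
    simp [realCoords]⟩

lemma add (hF : IsRealPolynomial F) (hH : IsRealPolynomial H) :
    IsRealPolynomial fun p u v => F p u v + H p u v := by
  obtain ⟨f, g, hf⟩ := hF
  obtain ⟨f', g', hf'⟩ := hH
  exact ⟨f + f', g + g', fun p u v => by simp only [hf, hf']; apply Complex.ext <;> simp⟩

lemma sub (hF : IsRealPolynomial F) (hH : IsRealPolynomial H) :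
    IsRealPolynomial fun p u v => F p u v - H p u v := by
  obtain ⟨f, g, hf⟩ := hF
  obtain ⟨f', g', hf'⟩ := hH
  exact ⟨f - f', g - g', fun p u v => by simp only [hf, hf']; apply Complex.ext <;> simp⟩

lemma mul (hF : IsRealPolynomial F) (hH : IsRealPolynomial H) :
    IsRealPolynomial fun p u v => F p u v * H p u v := by
  obtain ⟨f, g, hf⟩ := hF
  obtain ⟨f', g', hf'⟩ := hH
  exact ⟨f * f' - g * g', f * g' + g * f', fun p u v => by
    simp only [hf, hf']; apply Complex.ext <;> simp⟩

lemma star (hF : IsRealPolynomial F) : IsRealPolynomial fun p u v => conj (F p u v) := by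
  obtain ⟨f, g, hf⟩ := hF
  exact ⟨f, -g, fun p u v => by simp only [hf]; apply Complex.ext <;> simp⟩

lemma im (hF : IsRealPolynomial F) : IsRealPolynomial fun p u v => ((F p u v).im : ℂ) := by
  obtain ⟨f, g, hf⟩ := hF
  exact ⟨g, 0, fun p u v => by simp only [hf]; apply Complex.ext <;> simp⟩

lemma plucker (i j : Fin 4) : IsRealPolynomial fun _ u v => plucker u v i j :=
  ((coord 1 i).mul (coord 2 j)).sub ((coord 1 j).mul (coord 2 i))

lemma minor (i j k : Fin 4) : IsRealPolynomial fun p u v => minor p u v i j k :=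
  (((coord 0 i).mul (plucker j k)).sub ((coord 0 j).mul (plucker i k))).add
    ((coord 0 k).mul (plucker i j))

/-- The sum of squares of the real and imaginary parts is one real polynomial with the same zeros as
`F`; the given point shows that it is not the zero polynomial. -/
lemma forGenericPlane (hF : IsRealPolynomial F) {p₀ u₀ v₀ : Fin 4 → ℂ} (h₀ : F p₀ u₀ v₀ ≠ 0)
    {P : AffineSubspace ℂ (Fin 4 → ℂ) → Prop}
    (hP : ∀ p u v, LinearIndependent ℂ ![u, v] → F p u v ≠ 0 →
      P (AffineSubspace.mk' p (Submodule.span ℂ {u, v}))) : ForGenericPlane P := by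
  obtain ⟨f, g, hf⟩ := hF
  have key : ∀ p u v, MvPolynomial.eval (realCoords p u v) (f * f + g * g) =
      Complex.normSq (F p u v) := fun p u v => by
    rw [hf, Complex.normSq_mk, map_add, map_mul, map_mul]
  refine ⟨f * f + g * g, fun h => h₀ ?_, fun p u v huv h => hP p u v huv ?_⟩
  · rw [← Complex.normSq_eq_zero, ← key, h, map_zero]
  · rwa [key, Ne, Complex.normSq_eq_zero] at h

end IsRealPolynomial

/-- The polynomial condition defining generic frames. -/
def genericCondition (p u v : Fin 4 → ℂ) : ℂ :=
  ((plucker u v 0 1 * plucker u v 2 3 * conj (plucker u v 0 3 * plucker u v 1 2)).im : ℂ) *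
    (minor p u v 0 1 2 * minor p u v 0 1 3 * (minor p u v 0 2 3 * minor p u v 1 2 3))

lemma isRealPolynomial_genericCondition : IsRealPolynomial genericCondition :=
  (((IsRealPolynomial.plucker 0 1).mul (.plucker 2 3)).mul
    ((IsRealPolynomial.plucker 0 3).mul (.plucker 1 2)).star).im.mul
    (((IsRealPolynomial.minor 0 1 2).mul (.minor 0 1 3)).mul
      ((IsRealPolynomial.minor 0 2 3).mul (.minor 1 2 3)))

lemma isGenericFrame_of_genericCondition_ne_zero {p u v : Fin 4 → ℂ}
    (h : genericCondition p u v ≠ 0) : IsGenericFrame p u v := by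
  simp only [genericCondition, ne_eq, mul_eq_zero, not_or, Complex.ofReal_eq_zero] at h
  exact ⟨h.1, h.2.1.1, h.2.1.2, h.2.2.1, h.2.2.2⟩

/-- The entry `Complex.I` makes the quotient of the two Plücker products `-1 - I`, which is not
real; the four minors are `1`, `5`, `5 - I` and `-4`. -/
lemma genericCondition_ne_zero :
    genericCondition ![0, 0, 1, 5] ![1, 0, 1, 1] ![0, 1, 1, Complex.I] ≠ 0 := by
  simp [genericCondition, minor, plucker, Complex.ext_iff]
  norm_num

lemma IsGenericFrame.nonempty {p u v : Fin 4 → ℂ} (h : IsGenericFrame p u v) :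
    (realDirectionLocus p u v).Nonempty := by
  obtain ⟨z, s, t, s', t', r, hz, hzV, hr0, hr⟩ := h.exists_critical
  refine ⟨z, ⟨s, t, hzV⟩, hz, s', t', ?_, fun l => ?_⟩
  · by_contra! h0
    refine hr0 (funext fun l => ?_)
    simpa [h0, hz l] using hr l
  · rw [← hr l, mul_left_comm, mul_comm (conj (z l)), Complex.mul_conj, ← Complex.ofReal_mul,
      Complex.ofReal_im]

theorem corollary3 :
    ForGenericPlane fun V =>
      criticalLocus V logMap = criticalLocus V argMap ∧
      criticalLocus V twoArgMap = criticalLocus V argMap ∧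
      (criticalLocus V argMap).Nonempty ∧
      IsSmoothSubmanifold 3 (criticalLocus V argMap) := by
  refine isRealPolynomial_genericCondition.forGenericPlane genericCondition_ne_zero
    fun p u v huv hF => ?_
  have h := isGenericFrame_of_genericCondition_ne_zero hF
  rw [criticalLocus_logMap huv, criticalLocus_argMap huv, criticalLocus_twoArgMap huv]
  exact ⟨rfl, rfl, h.nonempty, h.isSmoothSubmanifold⟩
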